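/- Let $d,m\ge 2$ be integers. For a real matrix $A$ and $r>0$ put $r^A=\sum_{k\ge0}\frac{(\ln r)^k A^k}{k!}$. Let $Q(\mathbb R^n)$ be the set of invertible real $n\times n$ matrices all of whose (complex) eigenvalues have positive real part, and let $M(\mathbb R^n)$ be the set of real $n\times n$ matrices all of whose eigenvalues have nonnegative real part and such that every eigenvalue with real part zero is a simple root of the minimal polynomial. Write $\stackrel{d}{=}$ for equality of all finite-dimensional distributions. Let $X=\{X(t),\,t\in\mathbb R^d\}$ be an $\mathbb R^m$-valued random field that is stochastically continuous (continuous in probability at every $t\in\mathbb R^d$) and proper (for each $t\ne0$ the support of the distribution of $X(t)$ is not contained in any affine hyperplane of $\mathbb R^m$), and let $E\in Q(\mathbb R^d)$. (i) Suppose that $X$ is operator-self-similar with time-variable scaling exponent $E$, i.e. for every $r>0$ there is a real $m\times m$ matrix $B(r)$ with $\{X(r^Et),\,t\in\mathbb R^d\}\stackrel{d}{=}\{B(r)X(t),\,t\in\mathbb R^d\}$. Then there exists $D\in M(\mathbb R^m)$ such that for all $r>0$ $$\{X(r^Et),\,t\in\mathbb R^d\}\stackrel{d}{=}\{r^DX(t),\,t\in\mathbb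 R^d\}.$$ Moreover, $D\in Q(\mathbb R^m)$ if and only if $X(0)=0$ almost surely. (ii) Suppose that $X$ is operator-self-similar in the sense of Hudson and Mason with time-variable scaling exponent $E$, i.e. for every $r>0$ there are a real $m\times m$ matrix $B(r)$ and a vector $a(r)\in\mathbb R^m$ with $\{X(r^Et),\,t\in\mathbb R^d\}\stackrel{d}{=}\{B(r)X(t)+a(r),\,t\in\mathbb R^d\}$. Then there exist $D\in M(\mathbb R^m)$ and a continuous function $b:(0,\infty)\to\mathbb R^m$ such that for all $r>0$ $$\{X(r^Et),\,t\in\mathbb R^d\}\stackrel{d}{=}\{r^DX(t)+b(r),\,t\in\mathbb R^d\}.$$ -/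

import Mathlib

open MeasureTheory Set Filter Topology

noncomputable section

namespace OSS

/-- The complex matrix with the same entries as the real matrix `A`. -/
def complexify {n : ℕ} (A : Matrix (Fin n) (Fin n) ℝ) : Matrix (Fin n) (Fin n) ℂ :=
  A.map (fun x : ℝ => (x : ℂ))

/-- `z : ℂ` is a (possibly non-real) eigenvalue of the real matrix `A`. -/
def IsEigenvalue {n : ℕ} (A : Matrix (Fin n) (Fin n) ℝ) (z : ℂ) : Prop :=
  Module.End.HasEigenvalue (Matrix.toLin' (complexify A)) z

/-- `Q(ℝⁿ)`: invertible matrices all of whose eigenvalues have positive real part. -/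
def Q (n : ℕ) : Set (Matrix (Fin n) (Fin n) ℝ) :=
  {A | IsUnit A ∧ ∀ z : ℂ, IsEigenvalue A z → 0 < z.re}

/-- `M(ℝⁿ)`: matrices all of whose eigenvalues have nonnegative real part and such that each
eigenvalue with zero real part is a simple root of the minimal polynomial. -/
def M (n : ℕ) : Set (Matrix (Fin n) (Fin n) ℝ) :=
  {A | ∀ z : ℂ, IsEigenvalue A z →
    0 ≤ z.re ∧ (z.re = 0 → (minpoly ℂ (complexify A)).rootMultiplicity z = 1)}

/-- The action of a real matrix on Euclidean space. -/
def act {n : ℕ} (A : Matrix (Fin n) (Fin n) ℝ) (x : EuclideanSpace ℝ (Fin n)) :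
    EuclideanSpace ℝ (Fin n) :=
  Matrix.toEuclideanCLM (𝕜 := ℝ) A x

/-- `r ^ A = ∑ₖ (log r)ᵏ Aᵏ / k!`, for `r > 0`. -/
def rpowMat {n : ℕ} (r : ℝ) (A : Matrix (Fin n) (Fin n) ℝ) : Matrix (Fin n) (Fin n) ℝ :=
  NormedSpace.exp (Real.log r • A)

/-- Equality of all finite-dimensional distributions. -/
def FDDEq {T Ω S : Type*} [MeasurableSpace Ω] [MeasurableSpace S] (P : Measure Ω)
    (X Y : T → Ω → S) : Prop :=
  ∀ I : Finset T,
    P.map (fun ω (t : I) => X (t : T) ω) = P.map (fun ω (t : I) => Y (t : T) ω)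

/-- A measure on `ℝᵐ` is full if its support lies in no (affine) hyperplane. -/
def IsFull {m : ℕ} (μ : Measure (EuclideanSpace ℝ (Fin m))) : Prop :=
  ∀ y : EuclideanSpace ℝ (Fin m), y ≠ 0 → ∀ c : ℝ, ¬ μ.support ⊆ {x | inner ℝ y x = c}

section Field

variable {d m : ℕ} {Ω : Type*} [MeasurableSpace Ω]

/-- A `(d, m)`-random field: each `X t` is a random vector. -/
def IsRandomField (X : EuclideanSpace ℝ (Fin d) → Ω → EuclideanSpace ℝ (Fin m)) : Prop :=
  ∀ t, Measurable (X t)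

/-- Continuity in probability at every `t`. -/
def StochasticallyContinuous (P : Measure Ω)
    (X : EuclideanSpace ℝ (Fin d) → Ω → EuclideanSpace ℝ (Fin m)) : Prop :=
  ∀ t, TendstoInMeasure P X (𝓝 t) (X t)

/-- For each `t ≠ 0` the distribution of `X t` is full. -/
def IsProper (P : Measure Ω)
    (X : EuclideanSpace ℝ (Fin d) → Ω → EuclideanSpace ℝ (Fin m)) : Prop :=
  ∀ t, t ≠ 0 → IsFull (P.map (X t))

/-- Operator-self-similarity with time-variable scaling exponent `E`. -/
def IsOSS (P : Measure Ω) (X : EuclideanSpace ℝ (Fin d) → Ω → EuclideanSpace ℝ (Fin m))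
    (E : Matrix (Fin d) (Fin d) ℝ) : Prop :=
  ∀ r : ℝ, 0 < r → ∃ B : Matrix (Fin m) (Fin m) ℝ,
    FDDEq P (fun t ω => X (act (rpowMat r E) t) ω) (fun t ω => act B (X t ω))

/-- Operator-self-similarity in the sense of Hudson and Mason with time-variable scaling
exponent `E`. -/
def IsOSSHudsonMason (P : Measure Ω)
    (X : EuclideanSpace ℝ (Fin d) → Ω → EuclideanSpace ℝ (Fin m))
    (E : Matrix (Fin d) (Fin d) ℝ) : Prop :=
  ∀ r : ℝ, 0 < r → ∃ (B : Matrix (Fin m) (Fin m) ℝ) (a : EuclideanSpace ℝ (Fin m)),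
    FDDEq P (fun t ω => X (act (rpowMat r E) t) ω) (fun t ω => act B (X t ω) + a)

end Field

end OSS

end

/-!
Write `e^{sE}` for the action of the scale `r = e^s` on the time variable, and encode an affine map
`x ↦ B x + a` of `ℝᵐ` as the linear map `(x, t) ↦ (B x + t a, t)` of `ℝᵐ × ℝ`. The pairs `(s, T)`
for which the field `X (e^{sE} t)` has the same law as `T` applied to `X t` form the set
`scalingSet`. Part (ii) uses all affine maps `T`, part (i) only those fixing the origin, which are
the linear ones; both are the affine maps fixing a given set `F` pointwise.

This set is a closed group that projects onto `ℝ`, and its elements over scales `s ≤ 1` are bounded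
(`isScalingGroup_scalingSet`). Closedness is stochastic continuity. Invertibility and boundedness
come from fullness of `X t₀` for one `t₀ ≠ 0`: a full vector satisfies no affine relation almost
surely (`IsFull.eq_zero_of_ae`), whereas maps `Tₙ` of norm tending to infinity would produce, after
normalisation, such a relation in the limit, because `e^{sE} t₀` stays bounded for `s ≤ 1` and so
the laws of `X (e^{sE} t₀)` are tight.

Such a group contains a one-parameter group `s ↦ exp (s G)` over `ℝ`
(`IsScalingGroup.exists_oneParameter`). Take elements `exp Zₙ` over scales `sₙ ↓ 0` which are as
near to `1` as possible. If `Zₙ / sₙ` has a bounded subsequence, a limit point of it is the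
generator `G`. Otherwise `Zₙ / ‖Zₙ‖` has a limit point `Z` for which `exp (u Z)` lies over the scale `0` for all
`u`, and `exp Zₙ * exp (-‖Zₙ‖ Z)` is nearer to `1` than `exp Zₙ`, a contradiction. The linear part
of `G` is the exponent `D`, and the translation part of `exp (s G)` is the continuous function `b`
(`exists_exponent`).

Boundedness over all scales `s ≤ 0` says that `r ^ D` is bounded for `r ≤ 1`. Evaluated on
eigenvectors, and on generalised eigenvectors of order two, this is the condition `D ∈ M(ℝᵐ)`.
As `r → 0`, the variable `X (r ^ E t₀)` tends to `X 0` in probability; if `X 0 = 0`, every limit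
point of `r ^ D` kills the full vector `X t₀`, so it is zero, and all eigenvalues of `D` have
positive real part. Conversely, if `D ∈ Q(ℝᵐ)` then `r ^ D → 0`, and `X 0`, which has the law of
`r ^ D X 0` for all `r`, vanishes.
-/

namespace OSS

/-! ### One-parameter groups in closed groups over the real line -/

section OneParameter

open NormedSpace Asymptotics

variable {𝔸 : Type*} [NormedRing 𝔸] [NormedAlgebra ℝ 𝔸]

/-- `H` is a closed group of pairs `(s, A)`, where `s` is a real scale (additive) and `A` an element
of the algebra (multiplicative), which projects onto the scales and whose elements over the scales
`s ≤ 1` are bounded. Only a right inverse of `A` is asked for. -/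
structure IsScalingGroup (H : Set (ℝ × 𝔸)) : Prop where
  isClosed : IsClosed H
  one_mem : (0, 1) ∈ H
  mul_mem : ∀ {s t : ℝ} {A B : 𝔸}, (s, A) ∈ H → (t, B) ∈ H → (s + t, A * B) ∈ H
  exists_inv : ∀ {s : ℝ} {A : 𝔸}, (s, A) ∈ H → ∃ B, (-s, B) ∈ H ∧ A * B = 1
  bounded : ∃ C, ∀ s A, (s, A) ∈ H → s ≤ 1 → ‖A‖ ≤ C
  exists_mem : ∀ s, ∃ A, (s, A) ∈ H

namespace IsScalingGroup

variable {H : Set (ℝ × 𝔸)}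

lemma exp_neg_mem [CompleteSpace 𝔸] (hH : IsScalingGroup H) {s : ℝ} {Z : 𝔸}
    (h : (s, exp Z) ∈ H) : (-s, exp (-Z)) ∈ H := by
  let _ : NormedAlgebra ℚ 𝔸 := NormedAlgebra.restrictScalars ℚ ℝ 𝔸
  obtain ⟨B, hB, hB1⟩ := hH.exists_inv h
  have : exp (-Z) = B := by
    have h1 : exp (-Z) * exp Z = 1 := by
      rw [← exp_add_of_commute ((Commute.refl Z).neg_left)]; simp
    calc exp (-Z) = exp (-Z) * (exp Z * B) := by rw [hB1, mul_one]
      _ = B := by rw [← mul_assoc, h1, one_mul]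
  rwa [this]

lemma exp_natCast_mem [CompleteSpace 𝔸] (hH : IsScalingGroup H) {s : ℝ} {Z : 𝔸}
    (h : (s, exp Z) ∈ H) (k : ℕ) : ((k : ℝ) * s, exp ((k : ℝ) • Z)) ∈ H := by
  let _ : NormedAlgebra ℚ 𝔸 := NormedAlgebra.restrictScalars ℚ ℝ 𝔸
  induction k with
  | zero => simpa using hH.one_mem
  | succ k ih =>
    have := hH.mul_mem ih h
    rw [← exp_add_of_commute ((Commute.refl Z).smul_left _)] at this
    convert this using 2
    · push_cast; ring
    · rw [Nat.cast_succ, add_smul, one_smul]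

lemma exp_intCast_mem [CompleteSpace 𝔸] (hH : IsScalingGroup H) {s : ℝ} {Z : 𝔸}
    (h : (s, exp Z) ∈ H) (k : ℤ) : ((k : ℝ) * s, exp ((k : ℝ) • Z)) ∈ H := by
  obtain ⟨n, rfl | rfl⟩ := k.eq_nat_or_neg
  · simpa using hH.exp_natCast_mem h n
  · simpa using hH.exp_neg_mem (hH.exp_natCast_mem h n)

/-- A limit direction of small elements of `H` is tangent to `H`: the elements
`⌊u / εₙ⌋ • (sₙ, Zₙ)` of the logarithm of `H` converge to `u • (σ, Z)`. -/
lemma exp_smul_mem_of_tendsto [CompleteSpace 𝔸] (hH : IsScalingGroup H)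
    {s ε : ℕ → ℝ} {Z : ℕ → 𝔸} {σ : ℝ} {D : 𝔸}
    (hmem : ∀ᶠ n in atTop, (s n, exp (Z n)) ∈ H) (hpos : ∀ᶠ n in atTop, 0 < ε n)
    (hε : Tendsto ε atTop (𝓝 0)) (hs : Tendsto (fun n => (ε n)⁻¹ * s n) atTop (𝓝 σ))
    (hZ : Tendsto (fun n => (ε n)⁻¹ • Z n) atTop (𝓝 D)) (u : ℝ) :
    (u * σ, exp (u • D)) ∈ H := by
  let _ : NormedAlgebra ℚ 𝔸 := NormedAlgebra.restrictScalars ℚ ℝ 𝔸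
  have hk : Tendsto (fun n => (⌊u / ε n⌋ : ℝ) * ε n) atTop (𝓝 u) := by
    refine tendsto_of_tendsto_of_tendsto_of_le_of_le' (g := fun n => u - ε n) (h := fun _ => u)
      (by simpa using tendsto_const_nhds.sub hε) tendsto_const_nhds ?_ ?_
    · filter_upwards [hpos] with n hn
      have h1 := (Int.sub_one_lt_floor (u / ε n)).le
      have := mul_le_mul_of_nonneg_right h1 hn.le
      rwa [sub_mul, div_mul_cancel₀ _ hn.ne', one_mul] at this
    · filter_upwards [hpos] with n hn
      have := mul_le_mul_of_nonneg_right (Int.floor_le (u / ε n)) hn.le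
      rwa [div_mul_cancel₀ _ hn.ne'] at this
  have h1 : Tendsto (fun n => (⌊u / ε n⌋ : ℝ) * s n) atTop (𝓝 (u * σ)) := by
    refine (hk.mul hs).congr' ?_
    filter_upwards [hpos] with n hn
    field_simp
  have h2 : Tendsto (fun n => exp ((⌊u / ε n⌋ : ℝ) • Z n)) atTop (𝓝 (exp (u • D))) := by
    refine ((exp_continuous (𝔸 := 𝔸)).tendsto _).comp ((hk.smul hZ).congr' ?_)
    filter_upwards [hpos] with n hn
    rw [smul_smul, mul_assoc, mul_inv_cancel₀ hn.ne', mul_one]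
  refine hH.isClosed.mem_of_tendsto (h1.prodMk_nhds h2) ?_
  filter_upwards [hmem] with n hn using hH.exp_intCast_mem hn _

variable [FiniteDimensional ℝ 𝔸]

/-- There are elements of `H` over scales `sₙ ↓ 0` which converge to `1` and which are nearest to
`1` among the elements of `H` over the same scale. -/
lemma exists_seq_nearest_one (hH : IsScalingGroup H) :
    ∃ (s : ℕ → ℝ) (A : ℕ → 𝔸), (∀ n, 0 < s n) ∧ Tendsto s atTop (𝓝 0) ∧
      Tendsto A atTop (𝓝 1) ∧ (∀ n, (s n, A n) ∈ H) ∧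
      ∀ n B, (s n, B) ∈ H → ‖A n - 1‖ ≤ ‖B - 1‖ := by
  have := FiniteDimensional.proper ℝ 𝔸
  obtain ⟨C, hC⟩ := hH.bounded
  have hs0 : Tendsto (fun n : ℕ => (1 : ℝ) / (n + 1)) atTop (𝓝 0) :=
    tendsto_one_div_add_atTop_nhds_zero_nat
  have hle : ∀ n : ℕ, (1 : ℝ) / (n + 1) ≤ 1 := fun n => by
    rw [div_le_one (by positivity)]; linarith [n.cast_nonneg (α := ℝ)]
  choose T hT using fun n : ℕ => hH.exists_mem (1 / ((n : ℝ) + 1))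
  obtain ⟨T0, -, φ, hφ, hlim⟩ := (isCompact_closedBall (0 : 𝔸) C).tendsto_subseq
    (x := T) fun n => by simpa using hC _ _ (hT n) (hle n)
  have hT0 : ((0 : ℝ), T0) ∈ H :=
    hH.isClosed.mem_of_tendsto ((hs0.comp hφ.tendsto_atTop).prodMk_nhds hlim)
      (Eventually.of_forall fun n => hT (φ n))
  obtain ⟨T1, hT1, hT01⟩ := hH.exists_inv hT0
  have hmin : ∀ n, ∃ A, ((1 : ℝ) / ((φ n : ℝ) + 1), A) ∈ H ∧
      ∀ B, ((1 : ℝ) / ((φ n : ℝ) + 1), B) ∈ H → ‖A - 1‖ ≤ ‖B - 1‖ := by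
    intro n
    have hcl : IsClosed {A : 𝔸 | ((1 : ℝ) / ((φ n : ℝ) + 1), A) ∈ H} :=
      hH.isClosed.preimage (Continuous.prodMk_right _)
    have hcpt : IsCompact {A : 𝔸 | ((1 : ℝ) / ((φ n : ℝ) + 1), A) ∈ H} :=
      (isCompact_closedBall (0 : 𝔸) C).of_isClosed_subset hcl
        fun A hA => by simpa using hC _ _ hA (hle _)
    obtain ⟨A, hA, hAmin⟩ := hcpt.exists_isMinOn ⟨_, hT (φ n)⟩
      (f := fun A => ‖A - 1‖) (by fun_prop)
    exact ⟨A, hA, fun B hB => hAmin hB⟩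
  choose A hA hAmin using hmin
  refine ⟨fun n => 1 / ((φ n : ℝ) + 1), A, fun n => by positivity,
    hs0.comp hφ.tendsto_atTop, ?_, hA, hAmin⟩
  -- `T (φ n) * T1` tends to `1` over the same scale, and `A n` is at least as near to `1`.
  rw [tendsto_iff_norm_sub_tendsto_zero]
  have hup : Tendsto (fun n => ‖T (φ n) * T1 - 1‖) atTop (𝓝 0) := by
    rw [← tendsto_iff_norm_sub_tendsto_zero, ← hT01]
    exact hlim.mul_const T1
  refine squeeze_zero (fun _ => norm_nonneg _) (fun n => hAmin n _ ?_) hup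
  simpa using hH.mul_mem (hT (φ n)) hT1

/-- If the logarithms `Zₙ` of the nearest elements were of larger order than the scales, then a
limit direction `Z` of `Zₙ` would be tangent to the fibre of `H` over the scale `0`, and
`exp Zₙ * exp (-‖Zₙ‖ • Z)` would be nearer to `1` than `exp Zₙ`. -/
lemma exists_frequently_norm_le (hH : IsScalingGroup H) {s : ℕ → ℝ} {Z : ℕ → 𝔸}
    (hs : ∀ n, 0 < s n) (hZ : Tendsto Z atTop (𝓝 0))
    (hmem : ∀ᶠ n in atTop, (s n, exp (Z n)) ∈ H)
    (hmin : ∀ᶠ n in atTop, ∀ B, (s n, B) ∈ H → ‖exp (Z n) - 1‖ ≤ ‖B - 1‖) :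
    ∃ C : ℝ, ∃ᶠ n in atTop, ‖Z n‖ ≤ C * s n := by
  let _ : NormedAlgebra ℚ 𝔸 := NormedAlgebra.restrictScalars ℚ ℝ 𝔸
  have := FiniteDimensional.complete ℝ 𝔸
  have := FiniteDimensional.proper ℝ 𝔸
  by_contra! hcon
  have hball : ∀ n, ‖Z n‖⁻¹ • Z n ∈ Metric.closedBall (0 : 𝔸) 1 := fun n => by
    rw [mem_closedBall_zero_iff, norm_smul, norm_inv, norm_norm]
    exact inv_mul_le_one
  obtain ⟨D, -, φ, hφ, hlim⟩ := (isCompact_closedBall (0 : 𝔸) 1).tendsto_subseq hball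
  have hφt := hφ.tendsto_atTop
  have hpos : ∀ᶠ n in atTop, 0 < ‖Z (φ n)‖ :=
    hφt.eventually ((hcon 0).mono fun n hn => by rwa [zero_mul] at hn)
  have hZ0 : Tendsto (fun n => Z (φ n)) atTop (𝓝 0) := hZ.comp hφt
  have hε : Tendsto (fun n => ‖Z (φ n)‖) atTop (𝓝 0) := by simpa using hZ0.norm
  have hratio : Tendsto (fun n => ‖Z (φ n)‖⁻¹ * s (φ n)) atTop (𝓝 0) := by
    rw [Metric.tendsto_nhds]
    intro δ hδ
    filter_upwards [hpos, hφt.eventually (hcon δ⁻¹)] with n hn h1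
    rw [dist_zero_right, Real.norm_of_nonneg (mul_nonneg (inv_nonneg.2 hn.le) (hs _).le),
      inv_mul_lt_iff₀ hn]
    rwa [inv_mul_lt_iff₀ hδ, mul_comm] at h1
  have htan : ∀ u : ℝ, ((0 : ℝ), exp (u • D)) ∈ H := fun u => by
    simpa using hH.exp_smul_mem_of_tendsto (hφt.eventually hmem) hpos hε hratio hlim u
  have hstrict : (fun p : 𝔸 × 𝔸 => exp p.1 - exp p.2 - (p.1 - p.2)) =o[𝓝 (0, 0)]
      fun p => p.1 - p.2 := by
    simpa using (hasStrictFDerivAt_exp_zero (𝕂 := ℝ) (𝔸 := 𝔸)).isLittleO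
  have hεD : Tendsto (fun n => ‖Z (φ n)‖ • D) atTop (𝓝 0) := by simpa using hε.smul_const D
  -- `Zₙ - ‖Zₙ‖ • Z = o(‖Zₙ‖)`, hence `exp Zₙ - exp (‖Zₙ‖ • Z) = o(‖Zₙ‖)`.
  have hdiff : (fun n => Z (φ n) - ‖Z (φ n)‖ • D) =o[atTop] fun n => Z (φ n) := by
    rw [← isLittleO_norm_right]
    have h1 : (fun n => ‖Z (φ n)‖⁻¹ • Z (φ n) - D) =o[atTop] fun _ => (1 : ℝ) :=
      (isLittleO_one_iff ℝ).2 (by simpa using hlim.sub_const D)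
    have h2 := (isBigO_refl (fun n => ‖Z (φ n)‖) atTop).smul_isLittleO h1
    refine h2.congr' ?_ (by simp)
    filter_upwards [hpos] with n hn
    rw [smul_sub, smul_smul, mul_inv_cancel₀ hn.ne', one_smul]
  have hexp : (fun n => exp (Z (φ n)) - exp (‖Z (φ n)‖ • D)) =o[atTop] fun n => Z (φ n) := by
    have h1 := (hstrict.comp_tendsto (hZ0.prodMk_nhds hεD)).trans hdiff
    simpa [Function.comp_def] using h1.add hdiff
  have hprod : (fun n => exp (Z (φ n)) * exp (-(‖Z (φ n)‖ • D)) - 1) =o[atTop]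
      fun n => Z (φ n) := by
    have h1 : (fun n => exp (-(‖Z (φ n)‖ • D))) =O[atTop] fun _ => (1 : ℝ) :=
      (((exp_continuous (𝔸 := 𝔸)).tendsto _).comp hεD.neg).isBigO_one ℝ
    have h2 := (hexp.norm_right.mul_isBigO h1).congr_right fun n => mul_one _
    refine h2.of_norm_right.congr_left fun n => ?_
    rw [sub_mul, ← exp_add_of_commute ((Commute.refl (‖Z (φ n)‖ • D)).neg_right), add_neg_cancel,
      exp_zero]
  have hnear : (fun n => exp (Z (φ n)) - 1) =o[atTop] fun n => Z (φ n) := by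
    refine (IsBigO.of_bound 1 ?_).trans_isLittleO hprod
    filter_upwards [hφt.eventually hmin, hφt.eventually hmem] with n h1 h2
    rw [one_mul]
    refine h1 _ ?_
    have := hH.mul_mem h2 (htan (-‖Z (φ n)‖))
    simpa using this
  have hlin : (fun n => exp (Z (φ n)) - 1 - Z (φ n)) =o[atTop] fun n => Z (φ n) := by
    simpa [Function.comp_def] using hstrict.comp_tendsto (hZ0.prodMk_nhds tendsto_const_nhds)
  -- `Zₙ = o(Zₙ)` is impossible for nonzero `Zₙ`.
  have hself : (fun n => Z (φ n)) =o[atTop] fun n => Z (φ n) := by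
    simpa using hnear.sub hlin
  exact isLittleO_irrefl (hpos.mono fun n hn => norm_pos_iff.1 hn).frequently hself

/-- A scaling group contains a one-parameter group which is parametrised by the scale. -/
theorem exists_oneParameter (hH : IsScalingGroup H) :
    ∃ D : 𝔸, ∀ u : ℝ, (u, exp (u • D)) ∈ H := by
  have := FiniteDimensional.complete ℝ 𝔸
  have := FiniteDimensional.proper ℝ 𝔸
  obtain ⟨s, A, hs, hs0, hA, hmem, hmin⟩ := hH.exists_seq_nearest_one
  have hd : HasStrictFDerivAt (exp : 𝔸 → 𝔸)
      ((ContinuousLinearEquiv.refl ℝ 𝔸 : 𝔸 ≃L[ℝ] 𝔸) : 𝔸 →L[ℝ] 𝔸) 0 :=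
    hasStrictFDerivAt_exp_zero (𝕂 := ℝ) (𝔸 := 𝔸)
  let Z : ℕ → 𝔸 := fun n => hd.localInverse _ _ _ (A n)
  have hA' : Tendsto A atTop (𝓝 (exp (0 : 𝔸))) := by simpa using hA
  have hexp : ∀ᶠ n in atTop, exp (Z n) = A n := hA'.eventually hd.eventually_right_inverse
  have hZ : Tendsto Z atTop (𝓝 0) := hd.localInverse_tendsto.comp hA'
  have hmem' : ∀ᶠ n in atTop, (s n, exp (Z n)) ∈ H := by
    filter_upwards [hexp] with n hn
    rw [hn]; exact hmem n
  obtain ⟨C, hC⟩ := hH.exists_frequently_norm_le hs hZ hmem' <| by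
    filter_upwards [hexp] with n hn
    rw [hn]; exact hmin n
  obtain ⟨φ, hφ, hφC⟩ := extraction_of_frequently_atTop hC
  have hball : ∀ n, (s (φ n))⁻¹ • Z (φ n) ∈ Metric.closedBall (0 : 𝔸) C := fun n => by
    rw [mem_closedBall_zero_iff, norm_smul, norm_inv, Real.norm_of_nonneg (hs _).le,
      inv_mul_le_iff₀ (hs _), mul_comm]
    exact hφC n
  obtain ⟨D, -, ψ, hψ, hlim⟩ := (isCompact_closedBall (0 : 𝔸) C).tendsto_subseq hball
  have ht := hφ.tendsto_atTop.comp hψ.tendsto_atTop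
  refine ⟨D, fun u => ?_⟩
  have := hH.exp_smul_mem_of_tendsto (s := fun n => s (φ (ψ n))) (ε := fun n => s (φ (ψ n)))
    (Z := fun n => Z (φ (ψ n))) (σ := 1) (D := D) (ht.eventually hmem')
    (Eventually.of_forall fun n => hs _) (hs0.comp ht) ?_ hlim u
  · simpa using this
  · exact tendsto_const_nhds.congr fun n => (inv_mul_cancel₀ (hs _).ne').symm

end IsScalingGroup

end OneParameter

/-! ### Matrix exponentials and the classes `Q` and `M` -/

section MatrixExponential

open NormedSpace Matrix

variable {n : ℕ}

/-- The exponential series of `N` terminates on a vector killed by a power of `N`. -/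
lemma exp_mulVec_eq_sum {N : Matrix (Fin n) (Fin n) ℂ} {w : Fin n → ℂ} {k : ℕ}
    (h : (N ^ k) *ᵥ w = 0) :
    exp N *ᵥ w = ∑ j ∈ Finset.range k, (j.factorial⁻¹ : ℂ) • ((N ^ j) *ᵥ w) := by
  open scoped Matrix.Norms.Operator in
  have hs := exp_series_hasSum_exp' (𝕂 := ℂ) N
  have hs' := hs.map ((mulVecBilin ℂ ℂ).flip w).toAddMonoidHom
    (LinearMap.continuous_of_finiteDimensional _)
  have h0 : ∀ j ∉ Finset.range k,
      (((mulVecBilin ℂ ℂ).flip w).toAddMonoidHom ∘ fun j => (j.factorial⁻¹ : ℂ) • N ^ j) j = 0 := by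
    intro j hj
    obtain ⟨i, rfl⟩ := Nat.exists_eq_add_of_le' (not_lt.1 (Finset.mem_range.not.1 hj))
    simp [pow_add, h]
  refine (hs'.unique (hasSum_sum_of_ne_finset_zero h0)).trans (Finset.sum_congr rfl fun j _ => ?_)
  exact smul_mulVec (j.factorial⁻¹ : ℂ) (N ^ j) w

/-- The exponential on a generalised eigenvector. -/
lemma exp_smul_mulVec_eq {A : Matrix (Fin n) (Fin n) ℂ} {z : ℂ} {w : Fin n → ℂ} {k : ℕ}
    (h : ((A - z • 1) ^ k) *ᵥ w = 0) (u : ℂ) :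
    exp (u • A) *ᵥ w = Complex.exp (u * z) •
      ∑ j ∈ Finset.range k, (u ^ j * (j.factorial⁻¹ : ℂ)) • (((A - z • 1) ^ j) *ᵥ w) := by
  have h1 : u • A = (u * z) • (1 : Matrix (Fin n) (Fin n) ℂ) + u • (A - z • 1) := by
    rw [smul_sub, smul_smul]; abel
  have h2 : ((u • (A - z • 1)) ^ k) *ᵥ w = 0 := by
    rw [smul_pow, smul_mulVec, h, smul_zero]
  have h3 : exp ((u * z) • (1 : Matrix (Fin n) (Fin n) ℂ)) = Complex.exp (u * z) • 1 := by
    rw [smul_one_eq_diagonal, Matrix.exp_diagonal, smul_one_eq_diagonal]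
    congr 1
    ext i
    rw [Pi.coe_exp, Complex.exp_eq_exp_ℂ]
  rw [h1, Matrix.exp_add_of_commute _ _ ((Commute.one_left _).smul_left _), h3, smul_mul_assoc,
    one_mul, smul_mulVec, exp_mulVec_eq_sum h2]
  congr 1
  refine Finset.sum_congr rfl fun j _ => ?_
  rw [smul_pow, smul_mulVec, smul_smul, mul_comm]

lemma tendsto_exp_mul_pow_atBot {z : ℂ} (hz : 0 < z.re) (j : ℕ) :
    Tendsto (fun u : ℝ => Complex.exp (u * z) * (u : ℂ) ^ j) atBot (𝓝 0) := by
  rw [tendsto_zero_iff_norm_tendsto_zero]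
  have h1 : Tendsto (fun u : ℝ => -u * z.re) atBot atTop :=
    tendsto_neg_atBot_atTop.atTop_mul_const hz
  have h2 := ((Real.tendsto_pow_mul_exp_neg_atTop_nhds_zero j).comp h1).abs.mul_const
    ((z.re ^ j)⁻¹)
  simp only [abs_zero, zero_mul] at h2
  refine h2.congr fun u => ?_
  have : z.re ^ j ≠ 0 := (pow_pos hz j).ne'
  simp only [Function.comp, norm_mul, norm_pow, Complex.norm_exp, Complex.norm_real, Complex.mul_re,
    Complex.ofReal_re, Complex.ofReal_im, zero_mul, sub_zero, abs_mul, abs_pow, abs_neg,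
    Real.norm_eq_abs, abs_of_pos hz, Real.abs_exp, mul_pow]
  field_simp

lemma tendsto_exp_smul_mulVec_atBot {A : Matrix (Fin n) (Fin n) ℂ}
    (hA : ∀ z, Module.End.HasEigenvalue (Matrix.toLin' A) z → 0 < z.re) (w : Fin n → ℂ) :
    Tendsto (fun u : ℝ => exp ((u : ℂ) • A) *ᵥ w) atBot (𝓝 0) := by
  have hw : w ∈ ⨆ z, Module.End.maxGenEigenspace (Matrix.toLin' A) z := by
    rw [Module.End.iSup_maxGenEigenspace_eq_top]; trivial
  induction hw using Submodule.iSup_induction' with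
  | zero => simp
  | add x y _ _ hx hy => simpa [mulVec_add] using hx.add hy
  | mem z w hw =>
    obtain ⟨k, hk⟩ := Module.End.mem_maxGenEigenspace _ _ _ |>.1 hw
    by_cases hw0 : w = 0
    · simp [hw0]
    have hz : 0 < z.re := by
      refine hA z (Module.End.hasEigenvalue_of_hasGenEigenvalue (k := k) ?_)
      rw [Module.End.hasGenEigenvalue_iff, Submodule.ne_bot_iff]
      exact ⟨w, (Module.End.mem_genEigenspace_nat ..).2 hk, hw0⟩
    have hk' : ((A - z • 1) ^ k) *ᵥ w = 0 := by
      rw [← Matrix.toLin'_apply, Matrix.toLin'_pow, map_sub, map_smul, Matrix.toLin'_one]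
      exact hk
    simp_rw [exp_smul_mulVec_eq hk', Finset.smul_sum, smul_smul, ← mul_assoc]
    have : ∀ j ∈ Finset.range k, Tendsto (fun u : ℝ =>
        (Complex.exp (u * z) * (u : ℂ) ^ j * (j.factorial⁻¹ : ℂ)) • (((A - z • 1) ^ j) *ᵥ w))
        atBot (𝓝 0) := fun j _ => by
      simpa using ((tendsto_exp_mul_pow_atBot hz j).mul_const (j.factorial⁻¹ : ℂ)).smul_const
        (((A - z • 1) ^ j) *ᵥ w)
    simpa using tendsto_finsetSum _ this

lemma complexify_exp (A : Matrix (Fin n) (Fin n) ℝ) (u : ℝ) :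
    complexify (exp (u • A)) = exp ((u : ℂ) • complexify A) := by
  have h : complexify (u • A) = (u : ℂ) • complexify A := by
    ext i j; simp [complexify]
  rw [← h]
  open scoped Matrix.Norms.Operator in
  exact map_exp (Complex.ofRealHom.mapMatrix (m := Fin n))
    (continuous_id.matrix_map Complex.continuous_ofReal) _

lemma complexify_mulVec_ofReal (A : Matrix (Fin n) (Fin n) ℝ) (x : Fin n → ℝ) :
    complexify A *ᵥ (fun i => (x i : ℂ)) = fun i => ((A *ᵥ x) i : ℂ) := by
  ext i
  simp [complexify, mulVec, dotProduct]

lemma norm_ofReal_comp (x : Fin n → ℝ) : ‖(fun i => (x i : ℂ))‖ = ‖x‖ := by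
  simp [Pi.norm_def]

/-- If all eigenvalues of `A` have positive real part, `exp (u • A)` vanishes as `u → -∞`. -/
lemma tendsto_act_exp_of_mem_Q {A : Matrix (Fin n) (Fin n) ℝ} (hA : A ∈ Q n)
    (x : EuclideanSpace ℝ (Fin n)) :
    Tendsto (fun u : ℝ => act (exp (u • A)) x) atBot (𝓝 0) := by
  have h := tendsto_exp_smul_mulVec_atBot hA.2 fun i => (x i : ℂ)
  simp_rw [← complexify_exp, complexify_mulVec_ofReal] at h
  have h' : Tendsto (fun u : ℝ => exp (u • A) *ᵥ x.ofLp) atBot (𝓝 0) := by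
    rw [tendsto_zero_iff_norm_tendsto_zero] at h ⊢
    simpa only [norm_ofReal_comp] using h
  have h2 := ((PiLp.continuous_toLp 2 fun _ : Fin n => ℝ).tendsto 0).comp h'
  exact h2

lemma complexify_mulVec_eq (A : Matrix (Fin n) (Fin n) ℝ) (w : Fin n → ℂ) :
    complexify A *ᵥ w = (fun i => ((A *ᵥ fun i => (w i).re) i : ℂ)) +
      Complex.I • fun i => ((A *ᵥ fun i => (w i).im) i : ℂ) := by
  rw [← complexify_mulVec_ofReal, ← complexify_mulVec_ofReal, ← mulVec_smul, ← mulVec_add]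
  congr 1
  ext i
  simp [mul_comm Complex.I, Complex.re_add_im]

lemma norm_complexify_mulVec_le (A : Matrix (Fin n) (Fin n) ℝ) (w : Fin n → ℂ) :
    ‖complexify A *ᵥ w‖ ≤ ‖A *ᵥ fun i => (w i).re‖ + ‖A *ᵥ fun i => (w i).im‖ := by
  rw [complexify_mulVec_eq]
  refine (norm_add_le _ _).trans ?_
  rw [norm_smul, Complex.norm_I, one_mul, norm_ofReal_comp, norm_ofReal_comp]

lemma exp_smul_mulVec_of_hasEigenvector {A : Matrix (Fin n) (Fin n) ℂ} {z : ℂ} {v : Fin n → ℂ}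
    (hv : Module.End.HasEigenvector (Matrix.toLin' A) z v) (u : ℂ) :
    exp (u • A) *ᵥ v = Complex.exp (u * z) • v := by
  have h := hv.apply_eq_smul
  rw [Matrix.toLin'_apply] at h
  simpa using exp_smul_mulVec_eq (k := 1) (w := v) (by simp [sub_mulVec, smul_mulVec, h]) u

/-- If `z` is a multiple root of the minimal polynomial of `A`, there is a generalised eigenvector
of order two. -/
lemma exists_of_two_le_rootMultiplicity {A : Matrix (Fin n) (Fin n) ℂ} {z : ℂ}
    (h : 2 ≤ (minpoly ℂ A).rootMultiplicity z) :
    ∃ w : Fin n → ℂ, ((A - z • 1) ^ 2) *ᵥ w = 0 ∧ (A - z • 1) *ᵥ w ≠ 0 := by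
  open Polynomial in
  have hne : minpoly ℂ A ≠ 0 := minpoly.ne_zero (Matrix.isIntegral A)
  obtain ⟨q, hq⟩ := (le_rootMultiplicity_iff hne).1 h
  have hq0 : q ≠ 0 := by rintro rfl; simp [hne] at hq
  have hX : aeval A (X - C z) = A - z • 1 := by
    simp [Algebra.algebraMap_eq_smul_one]
  have hne' : (A - z • 1) * aeval A q ≠ 0 := by
    rw [← hX, ← map_mul]
    refine fun h0 => ?_
    have h1 : ((X - C z) * q) ≠ 0 := mul_ne_zero (X_sub_C_ne_zero z) hq0
    -- `(X - z) q` has smaller degree than the minimal polynomial `(X - z) ^ 2 q`.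
    have h2 := natDegree_le_of_dvd (minpoly.dvd ℂ A h0) h1
    have h3 : (minpoly ℂ A).natDegree = ((X - C z) * q).natDegree + 1 := by
      rw [hq, pow_two, mul_assoc, natDegree_mul (X_sub_C_ne_zero z) h1, natDegree_X_sub_C, add_comm]
    lia
  obtain ⟨x, hx⟩ : ∃ x, ((A - z • 1) * aeval A q) *ᵥ x ≠ 0 := by
    by_contra! hc
    exact hne' (Matrix.ext_of_mulVec_single fun i => by rw [hc, zero_mulVec])
  refine ⟨aeval A q *ᵥ x, ?_, by rwa [mulVec_mulVec]⟩
  rw [mulVec_mulVec, ← hX, ← map_pow, ← map_mul, ← hq, minpoly.aeval, zero_mulVec]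

/-- If `exp (u • A)` stays bounded as `u → -∞`, then `A ∈ M(ℝⁿ)`. -/
lemma mem_M_of_bounded {A : Matrix (Fin n) (Fin n) ℝ}
    (hA : ∀ x : Fin n → ℝ, ∃ C, ∀ u : ℝ, u ≤ 0 → ‖exp (u • A) *ᵥ x‖ ≤ C) : A ∈ M n := by
  have hA' : ∀ w : Fin n → ℂ, ∃ C, ∀ u : ℝ, u ≤ 0 →
      ‖exp ((u : ℂ) • complexify A) *ᵥ w‖ ≤ C := by
    intro w
    obtain ⟨C₁, h₁⟩ := hA fun i => (w i).re
    obtain ⟨C₂, h₂⟩ := hA fun i => (w i).im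
    refine ⟨C₁ + C₂, fun u hu => ?_⟩
    rw [← complexify_exp]
    exact (norm_complexify_mulVec_le _ _).trans (add_le_add (h₁ u hu) (h₂ u hu))
  intro z hz
  obtain ⟨v, hv⟩ := Module.End.HasEigenvalue.exists_hasEigenvector hz
  refine ⟨?_, fun hre => ?_⟩
  · by_contra! hneg
    obtain ⟨C, hC⟩ := hA' v
    have h1 : Tendsto (fun u : ℝ => Real.exp (u * z.re) * ‖v‖) atBot atTop :=
      (Real.tendsto_exp_atTop.comp (tendsto_id.atBot_mul_const_of_neg hneg)).atTop_mul_const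
        (norm_pos_iff.2 hv.2)
    obtain ⟨u, hu0, hu⟩ := ((eventually_le_atBot 0).and (h1.eventually_gt_atTop C)).exists
    have := hC u hu0
    rw [exp_smul_mulVec_of_hasEigenvector hv, norm_smul, Complex.norm_exp] at this
    simp at this
    linarith
  · refine le_antisymm ?_ ?_
    · by_contra! h2
      obtain ⟨w, hw2, hw1⟩ := exists_of_two_le_rootMultiplicity h2
      obtain ⟨C, hC⟩ := hA' w
      have h1 : Tendsto (fun u : ℝ => -u * ‖(complexify A - z • 1) *ᵥ w‖ - ‖w‖) atBot atTop :=
        tendsto_atTop_add_const_right _ _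
          (tendsto_neg_atBot_atTop.atTop_mul_const (norm_pos_iff.2 hw1))
      obtain ⟨u, hu0, hu⟩ := ((eventually_le_atBot 0).and (h1.eventually_gt_atTop C)).exists
      have h3 := hC u hu0
      have h4 : ‖Complex.exp (u * z)‖ = 1 := by simp [Complex.norm_exp, hre]
      rw [exp_smul_mulVec_eq hw2, norm_smul, h4, one_mul] at h3
      simp only [Finset.sum_range_succ, Finset.range_zero, Finset.sum_empty, zero_add, pow_zero,
        Nat.factorial, one_mulVec, pow_one, Nat.cast_one, inv_one, mul_one, one_smul] at h3
      have h5 : ‖(u : ℂ) • ((complexify A - z • 1) *ᵥ w)‖ =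
          -u * ‖(complexify A - z • 1) *ᵥ w‖ := by
        rw [norm_smul, Complex.norm_real, Real.norm_of_nonpos hu0]
      have h6 := norm_sub_le (w + (u : ℂ) • ((complexify A - z • 1) *ᵥ w)) w
      rw [add_sub_cancel_left, h5] at h6
      linarith
    · have hne : minpoly ℂ (complexify A) ≠ 0 := minpoly.ne_zero (Matrix.isIntegral _)
      rw [Nat.succ_le_iff, Polynomial.rootMultiplicity_pos hne, ← Matrix.minpoly_toLin']
      exact Module.End.isRoot_of_hasEigenvalue hz

/-- If `exp (u • A)` tends to zero along a sequence of times `u ≤ 0`, then `A ∈ Q(ℝⁿ)`. -/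
lemma mem_Q_of_tendsto {A : Matrix (Fin n) (Fin n) ℝ} {u : ℕ → ℝ} (hu : ∀ k, u k ≤ 0)
    (hA : ∀ x : Fin n → ℝ, Tendsto (fun k => exp (u k • A) *ᵥ x) atTop (𝓝 0)) : A ∈ Q n := by
  have hre : ∀ z : ℂ, IsEigenvalue A z → 0 < z.re := by
    intro z hz
    obtain ⟨v, hv⟩ := Module.End.HasEigenvalue.exists_hasEigenvector hz
    have h0 : Tendsto (fun k => ‖exp ((u k : ℂ) • complexify A) *ᵥ v‖) atTop (𝓝 0) := by
      refine squeeze_zero (fun _ => norm_nonneg _) (fun k => ?_)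
        (by simpa using (hA fun i => (v i).re).norm.add (hA fun i => (v i).im).norm)
      rw [← complexify_exp]
      exact norm_complexify_mulVec_le _ _
    by_contra! hneg
    have hvpos := norm_pos_iff.2 hv.2
    obtain ⟨k, hk⟩ := (h0.eventually_lt_const hvpos).exists
    rw [exp_smul_mulVec_of_hasEigenvector hv, norm_smul, Complex.norm_exp] at hk
    have h1 : 1 ≤ Real.exp ((u k * z : ℂ).re) := by
      rw [Real.one_le_exp_iff]
      simpa using mul_nonneg_of_nonpos_of_nonpos (hu k) hneg
    nlinarith
  refine ⟨?_, hre⟩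
  rw [Matrix.isUnit_iff_isUnit_det, isUnit_iff_ne_zero]
  intro hdet
  obtain ⟨x, hx, hAx⟩ := Matrix.exists_mulVec_eq_zero_iff.2 hdet
  refine lt_irrefl (0 : ℝ) (hre 0 (Module.End.hasEigenvalue_of_hasEigenvector
    (x := fun i => (x i : ℂ)) ⟨?_, fun h => hx ?_⟩))
  · rw [Module.End.mem_eigenspace_iff, Matrix.toLin'_apply, complexify_mulVec_ofReal, hAx]
    ext; simp
  · ext i; simpa using congrFun h i

end MatrixExponential

/-! ### Equality of laws, limits and full random vectors -/

section Laws

variable {Ω : Type*} [MeasurableSpace Ω] {P : Measure Ω}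

/-- Finite-dimensional distributions determine the law on the product space, so that `FDDEq` is an
equality of two measures and can be pushed forward. -/
lemma fddEq_iff_map_eq {T S : Type*} [MeasurableSpace S] [IsFiniteMeasure P] {X Y : T → Ω → S}
    (hX : ∀ t, Measurable (X t)) (hY : ∀ t, Measurable (Y t)) :
    FDDEq P X Y ↔ P.map (fun ω t => X t ω) = P.map (fun ω t => Y t ω) :=
  (ProbabilityTheory.map_eq_iff_forall_finset_map_restrict_eq
    (measurable_pi_lambda _ hX).aemeasurable (measurable_pi_lambda _ hY).aemeasurable).symm

lemma FDDEq.reindex {T T' S : Type*} [MeasurableSpace S] [IsFiniteMeasure P] {X Y : T → Ω → S}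
    (h : FDDEq P X Y) (hX : ∀ t, Measurable (X t)) (hY : ∀ t, Measurable (Y t)) (g : T' → T) :
    FDDEq P (fun t => X (g t)) (fun t => Y (g t)) := by
  rw [fddEq_iff_map_eq (fun _ => hX _) fun _ => hY _]
  have hm : Measurable fun (f : T → S) (t : T') => f (g t) := by fun_prop
  have := congrArg (Measure.map fun (f : T → S) (t : T') => f (g t))
    ((fddEq_iff_map_eq hX hY).1 h)
  rwa [Measure.map_map hm (measurable_pi_lambda _ hX),
    Measure.map_map hm (measurable_pi_lambda _ hY)] at this

lemma FDDEq.postcomp {T S S' : Type*} [MeasurableSpace S] [MeasurableSpace S'] [IsFiniteMeasure P]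
    {X Y : T → Ω → S} (h : FDDEq P X Y) (hX : ∀ t, Measurable (X t)) (hY : ∀ t, Measurable (Y t))
    {f : S → S'} (hf : Measurable f) :
    FDDEq P (fun t ω => f (X t ω)) (fun t ω => f (Y t ω)) := by
  refine (fddEq_iff_map_eq (fun _ => hf.comp (hX _)) fun _ => hf.comp (hY _)).2 ?_
  have hm : Measurable fun (g : T → S) (t : T) => f (g t) := by fun_prop
  have := congrArg (Measure.map fun (g : T → S) (t : T) => f (g t))
    ((fddEq_iff_map_eq hX hY).1 h)
  rwa [Measure.map_map hm (measurable_pi_lambda _ hX),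
    Measure.map_map hm (measurable_pi_lambda _ hY)] at this

lemma FDDEq.map_eq {T S : Type*} [MeasurableSpace S] [IsFiniteMeasure P] {X Y : T → Ω → S}
    (h : FDDEq P X Y) (hX : ∀ t, Measurable (X t)) (hY : ∀ t, Measurable (Y t)) (t : T) :
    P.map (X t) = P.map (Y t) := by
  have := congrArg (Measure.map fun f : T → S => f t) ((fddEq_iff_map_eq hX hY).1 h)
  rwa [Measure.map_map (by fun_prop) (measurable_pi_lambda _ hX),
    Measure.map_map (by fun_prop) (measurable_pi_lambda _ hY)] at this

/-- Equality in law passes to almost sure limits. -/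
lemma map_eq_of_tendsto_ae {S : Type*} [TopologicalSpace S] [HasOuterApproxClosed S]
    [MeasurableSpace S] [BorelSpace S] [IsFiniteMeasure P] {U W : ℕ → Ω → S} {U' W' : Ω → S}
    (hU : ∀ n, Measurable (U n)) (hW : ∀ n, Measurable (W n))
    (hU' : Measurable U') (hW' : Measurable W')
    (hlaw : ∀ n, P.map (U n) = P.map (W n))
    (hUlim : ∀ᵐ ω ∂P, Tendsto (fun n => U n ω) atTop (𝓝 (U' ω)))
    (hWlim : ∀ᵐ ω ∂P, Tendsto (fun n => W n ω) atTop (𝓝 (W' ω))) :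
    P.map U' = P.map W' := by
  refine ext_of_forall_integral_eq_of_IsFiniteMeasure fun f => ?_
  have key : ∀ {V : ℕ → Ω → S} {V' : Ω → S}, (∀ n, Measurable (V n)) → Measurable V' →
      (∀ᵐ ω ∂P, Tendsto (fun n => V n ω) atTop (𝓝 (V' ω))) →
      Tendsto (fun n => ∫ x, f x ∂(P.map (V n))) atTop (𝓝 (∫ x, f x ∂(P.map V'))) := by
    intro V V' hV hV' hlim
    have hf : Measurable f := f.continuous.measurable
    rw [integral_map hV'.aemeasurable hf.aestronglyMeasurable]
    simp_rw [fun n => integral_map (hV n).aemeasurable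
      (hf.aestronglyMeasurable (μ := P.map (V n)))]
    refine tendsto_integral_of_dominated_convergence (fun _ => ‖f‖)
      (fun n => (hf.comp (hV n)).aestronglyMeasurable) (integrable_const _)
      (fun n => ae_of_all _ fun ω => f.norm_coe_le_norm _) ?_
    filter_upwards [hlim] with ω hω using (f.continuous.tendsto _).comp hω
  refine tendsto_nhds_unique (key hU hU' hUlim) ?_
  simp_rw [hlaw]
  exact key hW hW' hWlim

/-- Finitely many sequences converging in measure have a common subsequence converging almost
surely. -/
lemma exists_subseq_tendsto_ae {ι V : Type*} [PseudoEMetricSpace V] {f : ι → ℕ → Ω → V}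
    {g : ι → Ω → V} (I : Finset ι) (h : ∀ i ∈ I, TendstoInMeasure P (f i) atTop (g i)) :
    ∃ φ : ℕ → ℕ, StrictMono φ ∧
      ∀ᵐ ω ∂P, ∀ i ∈ I, Tendsto (fun n => f i (φ n) ω) atTop (𝓝 (g i ω)) := by
  classical
  induction I using Finset.induction_on with
  | empty => exact ⟨id, strictMono_id, by simp⟩
  | insert a I _ ih =>
    obtain ⟨φ, hφ, hφI⟩ := ih fun i hi => h i (Finset.mem_insert_of_mem hi)
    obtain ⟨ψ, hψ, hψa⟩ := ((h a (Finset.mem_insert_self a I)).comp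
      hφ.tendsto_atTop).exists_seq_tendsto_ae
    refine ⟨φ ∘ ψ, hφ.comp hψ, ?_⟩
    filter_upwards [hφI, hψa] with ω h1 h2 i hi
    rcases Finset.mem_insert.1 hi with rfl | hi
    · exact h2
    · exact (h1 i hi).comp hψ.tendsto_atTop

lemma ae_eq_of_map_eq_of_ae_eq_const {S : Type*} [MeasurableSpace S] [MeasurableSingletonClass S]
    {U W : Ω → S} (hU : Measurable U) (hW : Measurable W) (h : P.map U = P.map W) {c : S}
    (hc : ∀ᵐ ω ∂P, U ω = c) : ∀ᵐ ω ∂P, W ω = c := by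
  have hs : MeasurableSet {x : S | x = c} := measurableSet_singleton c
  rwa [← ae_map_iff hW.aemeasurable hs, ← h, ae_map_iff hU.aemeasurable hs]

/-- A full random vector satisfies no nontrivial affine relation almost surely. Affine maps of `x`
are written as linear maps of `(x, 1)`. -/
lemma IsFull.eq_zero_of_ae {m : ℕ} [IsProbabilityMeasure P] {Y : Ω → EuclideanSpace ℝ (Fin m)}
    (hfull : IsFull (P.map Y)) (hY : Measurable Y) {F : Type*} [NormedAddCommGroup F]
    [NormedSpace ℝ F] {S : EuclideanSpace ℝ (Fin m) × ℝ →L[ℝ] F}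
    (hS : ∀ᵐ ω ∂P, S (Y ω, 1) = 0) : S = 0 := by
  have hsplit : ∀ x : EuclideanSpace ℝ (Fin m), ∀ t : ℝ, S (x, t) = S (x, 0) + t • S (0, 1) := by
    intro x t
    rw [← map_smul, ← map_add]; simp
  have hlin : ∀ x, S (x, 0) = 0 := by
    intro x
    refine SeparatingDual.eq_zero_of_forall_dual_eq_zero (R := ℝ) fun ψ => ?_
    set y := (InnerProductSpace.toDual ℝ (EuclideanSpace ℝ (Fin m))).symm
      ((ψ.comp S).comp (ContinuousLinearMap.inl ℝ _ _)) with hy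
    have hyx : ∀ x, inner ℝ y x = ψ (S (x, 0)) := fun x => by
      rw [hy, InnerProductSpace.toDual_symm_apply]; simp
    rw [← hyx]
    by_contra hne
    have hy0 : y ≠ 0 := by rintro h; simp [h] at hne
    have hcl : IsClosed {x | inner ℝ y x = -ψ (S (0, 1))} :=
      isClosed_eq (by fun_prop) continuous_const
    refine hfull y hy0 (-ψ (S (0, 1))) (Measure.support_subset_of_isClosed hcl ?_)
    refine (ae_map_iff hY.aemeasurable hcl.measurableSet).2 ?_
    filter_upwards [hS] with ω hω
    rw [hsplit, one_smul] at hω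
    rw [hyx, ← map_neg, eq_neg_of_add_eq_zero_left hω]
  have h1 : S (0, 1) = 0 := by
    obtain ⟨ω, hω⟩ := hS.exists
    rwa [hsplit, hlin, zero_add, one_smul] at hω
  ext p
  · simp [hlin]
  · simp [h1]

end Laws

/-! ### The group of scalings of a random field -/

section Scaling

open NormedSpace

variable {d m : ℕ} {Ω : Type*} [MeasurableSpace Ω] {P : Measure Ω}
  {X : EuclideanSpace ℝ (Fin d) → Ω → EuclideanSpace ℝ (Fin m)} {E : Matrix (Fin d) (Fin d) ℝ}

lemma exp_add_smul_apply {V : Type*} [NormedAddCommGroup V] [NormedSpace ℝ V] [CompleteSpace V]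
    (A : V →L[ℝ] V) (s s' : ℝ) (x : V) :
    exp ((s + s') • A) x = exp (s • A) (exp (s' • A) x) := by
  let _ : NormedAlgebra ℚ (V →L[ℝ] V) := NormedAlgebra.restrictScalars ℚ ℝ _
  rw [add_smul, exp_add_of_commute (((Commute.refl _).smul_left _).smul_right _)]
  rfl

lemma exp_zero_smul_apply {V : Type*} [NormedAddCommGroup V] [NormedSpace ℝ V]
    (A : V →L[ℝ] V) (x : V) : exp ((0 : ℝ) • A) x = x := by
  simp

lemma continuous_exp_smul_apply {V : Type*} [NormedAddCommGroup V] [NormedSpace ℝ V]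
    [CompleteSpace V] (A : V →L[ℝ] V) (x : V) : Continuous fun s : ℝ => exp (s • A) x := by
  let _ : NormedAlgebra ℚ (V →L[ℝ] V) := NormedAlgebra.restrictScalars ℚ ℝ _
  have : Continuous fun s : ℝ => exp (s • A) := exp_continuous.comp (by fun_prop)
  exact this.clm_apply continuous_const

lemma act_exp_smul (A : Matrix (Fin d) (Fin d) ℝ) (s : ℝ) (x : EuclideanSpace ℝ (Fin d)) :
    act (exp (s • A)) x = exp (s • Matrix.toEuclideanCLM (𝕜 := ℝ) A) x := by
  open scoped Matrix.Norms.L2Operator in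
  let _ : NormedAlgebra ℚ (Matrix (Fin d) (Fin d) ℝ) := NormedAlgebra.restrictScalars ℚ ℝ _
  have h := map_exp (Matrix.toEuclideanCLM (n := Fin d) (𝕜 := ℝ))
    (AddMonoidHomClass.continuous_of_bound _ 1 fun B => by
      rw [one_mul, Matrix.l2_opNorm_toEuclideanCLM]) (s • A)
  rw [map_smul] at h
  exact congrArg (fun T => T x) h

/-- The one-parameter group `s ↦ e ^ (s E)` acting on the time variable. -/
noncomputable def flow (E : Matrix (Fin d) (Fin d) ℝ) (s : ℝ) (t : EuclideanSpace ℝ (Fin d)) :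
    EuclideanSpace ℝ (Fin d) :=
  act (exp (s • E)) t

lemma flow_add (s s' : ℝ) (t : EuclideanSpace ℝ (Fin d)) :
    flow E (s + s') t = flow E s (flow E s' t) := by
  simp only [flow, act_exp_smul]
  exact exp_add_smul_apply _ _ _ _

@[simp]
lemma flow_zero_left (t : EuclideanSpace ℝ (Fin d)) : flow E 0 t = t := by
  rw [flow, act_exp_smul]
  exact exp_zero_smul_apply _ _

@[simp]
lemma flow_zero_right (s : ℝ) : flow E s 0 = 0 := by
  rw [flow, act_exp_smul, map_zero]

lemma flow_ne_zero (s : ℝ) {t : EuclideanSpace ℝ (Fin d)} (ht : t ≠ 0) : flow E s t ≠ 0 := by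
  intro h
  refine ht ?_
  rw [← flow_zero_left (E := E) t, ← neg_add_cancel s, flow_add, h, flow_zero_right]

lemma continuous_flow (t : EuclideanSpace ℝ (Fin d)) : Continuous fun s => flow E s t := by
  simp only [flow, act_exp_smul]
  exact continuous_exp_smul_apply _ _

lemma tendsto_flow_atBot (hE : E ∈ Q d) (t : EuclideanSpace ℝ (Fin d)) :
    Tendsto (fun s => flow E s t) atBot (𝓝 0) :=
  tendsto_act_exp_of_mem_Q hE t

/-- The points `e^{sE} t` for `s ≤ 1` form a bounded set, since `e^{sE} t → 0` as `s → -∞`. -/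
lemma exists_norm_flow_le (hE : E ∈ Q d) (t : EuclideanSpace ℝ (Fin d)) :
    ∃ R, ∀ s ≤ 1, ‖flow E s t‖ ≤ R := by
  obtain ⟨a, ha⟩ := eventually_atBot.1
    ((tendsto_flow_atBot hE t).norm.eventually_le_const 
      (by simp : ‖(0 : EuclideanSpace ℝ (Fin d))‖ < 1))
  obtain ⟨R, hR⟩ := (isCompact_Icc (a := a) (b := 1)).exists_bound_of_continuousOn
    (continuous_flow (E := E) t).continuousOn
  refine ⟨max R 1, fun s hs => ?_⟩
  rcases le_total s a with h | h
  · exact (ha s h).trans (le_max_right _ _)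
  · exact (hR s ⟨h, hs⟩).trans (le_max_left _ _)

/-- The map `x ↦ B x + a` encoded by the operator `T : (x, t) ↦ (B x + t a, t)` on `ℝᵐ × ℝ`. -/
noncomputable def affAct (T : EuclideanSpace ℝ (Fin m) × ℝ →L[ℝ] EuclideanSpace ℝ (Fin m) × ℝ)
    (x : EuclideanSpace ℝ (Fin m)) : EuclideanSpace ℝ (Fin m) :=
  (T (x, 1)).1

/-- `T` is the operator `(x, t) ↦ (B x + t a, t)` of an affine map `x ↦ B x + a` which fixes the
points of `F`. For `F = ∅` the map is arbitrary, for `F = {0}` it is linear. -/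
structure IsAffineFixing (F : Set (EuclideanSpace ℝ (Fin m)))
    (T : EuclideanSpace ℝ (Fin m) × ℝ →L[ℝ] EuclideanSpace ℝ (Fin m) × ℝ) : Prop where
  snd_apply : ∀ p, (T p).2 = p.2
  fixes : ∀ x ∈ F, T (x, 1) = (x, 1)

lemma IsAffineFixing.apply_one {F : Set (EuclideanSpace ℝ (Fin m))}
    {T : EuclideanSpace ℝ (Fin m) × ℝ →L[ℝ] EuclideanSpace ℝ (Fin m) × ℝ}
    (hT : IsAffineFixing F T) (x : EuclideanSpace ℝ (Fin m)) : T (x, 1) = (affAct T x, 1) :=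
  Prod.ext rfl (hT.snd_apply _)

lemma measurable_affAct
    (T : EuclideanSpace ℝ (Fin m) × ℝ →L[ℝ] EuclideanSpace ℝ (Fin m) × ℝ) :
    Measurable (affAct T) := by
  unfold affAct
  exact (by fun_prop : Continuous fun x : EuclideanSpace ℝ (Fin m) => (T (x, 1)).1).measurable

lemma isClosed_isAffineFixing (F : Set (EuclideanSpace ℝ (Fin m))) :
    IsClosed {T | IsAffineFixing F T} := by
  have : {T | IsAffineFixing F T} =
      (⋂ p, {T | (T p).2 = p.2}) ∩ ⋂ x ∈ F, {T | T (x, 1) = (x, 1)} := by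
    ext T
    simp only [mem_inter_iff, mem_iInter]
    exact ⟨fun h => ⟨h.1, h.2⟩, fun h => ⟨h.1, h.2⟩⟩
  rw [this]
  refine (isClosed_iInter fun p => isClosed_eq ?_ continuous_const).inter
    (isClosed_biInter fun x _ => isClosed_eq ?_ continuous_const) <;> fun_prop

/-- The pairs `(s, T)` such that `T` encodes an affine map fixing the points of `F` and carries the
law of the field `X t` to the law of the field `X (e^{sE} t)`. -/
def scalingSet (P : Measure Ω) (X : EuclideanSpace ℝ (Fin d) → Ω → EuclideanSpace ℝ (Fin m))
    (E : Matrix (Fin d) (Fin d) ℝ) (F : Set (EuclideanSpace ℝ (Fin m))) :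
    Set (ℝ × (EuclideanSpace ℝ (Fin m) × ℝ →L[ℝ] EuclideanSpace ℝ (Fin m) × ℝ)) :=
  {q | IsAffineFixing F q.2 ∧
    FDDEq P (fun t ω => X (flow E q.1 t) ω) (fun t ω => affAct q.2 (X t ω))}

section

variable {F : Set (EuclideanSpace ℝ (Fin m))}

lemma isClosed_scalingSet [IsProbabilityMeasure P] (hX : IsRandomField X)
    (hcont : StochasticallyContinuous P X) :
    IsClosed (scalingSet P X E F) := by
  refine IsSeqClosed.isClosed fun q q' hq hlim => ?_
  have hlim1 := (continuous_fst.tendsto q').comp hlim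
  have hlim2 := (continuous_snd.tendsto q').comp hlim
  refine ⟨(isClosed_isAffineFixing F).mem_of_tendsto hlim2
    (Eventually.of_forall fun n => (hq n).1), fun I => ?_⟩
  obtain ⟨φ, hφ, hae⟩ := exists_subseq_tendsto_ae I
    (f := fun t n => X (flow E (q n).1 t)) (g := fun t => X (flow E q'.1 t)) fun t _ =>
      (hcont _).comp (((continuous_flow t).tendsto _).comp hlim1)
  refine map_eq_of_tendsto_ae
    (U := fun n ω (t : I) => X (flow E (q (φ n)).1 t) ω)
    (W := fun n ω (t : I) => affAct (q (φ n)).2 (X t ω))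
    (fun n => measurable_pi_lambda _ fun t => hX _)
    (fun n => measurable_pi_lambda _ fun t => (measurable_affAct _).comp (hX _))
    (measurable_pi_lambda _ fun t => hX _)
    (measurable_pi_lambda _ fun t => (measurable_affAct _).comp (hX _))
    (fun n => (hq (φ n)).2 I) ?_ (ae_of_all _ fun ω => ?_)
  · filter_upwards [hae] with ω hω
    exact tendsto_pi_nhds.2 fun t => hω t t.2
  · refine tendsto_pi_nhds.2 fun t => ?_
    have h : Continuous fun T : EuclideanSpace ℝ (Fin m) × ℝ →L[ℝ] EuclideanSpace ℝ (Fin m) × ℝ =>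
      affAct T (X t ω) := by unfold affAct; fun_prop
    exact (h.tendsto _).comp (hlim2.comp hφ.tendsto_atTop)

lemma one_mem_scalingSet : (0, 1) ∈ scalingSet P X E F :=
  ⟨⟨fun _ => rfl, fun _ _ => rfl⟩, fun I => by simp [affAct]⟩

variable [IsProbabilityMeasure P]

lemma mul_mem_scalingSet (hX : IsRandomField X) {s s' : ℝ}
    {T T' : EuclideanSpace ℝ (Fin m) × ℝ →L[ℝ] EuclideanSpace ℝ (Fin m) × ℝ}
    (h : (s, T) ∈ scalingSet P X E F) (h' : (s', T') ∈ scalingSet P X E F) :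
    (s + s', T * T') ∈ scalingSet P X E F := by
  refine ⟨⟨fun p => by simp [h.1.snd_apply, h'.1.snd_apply], fun x hx => by
    simp [h.1.fixes x hx, h'.1.fixes x hx]⟩, fun I => ?_⟩
  have h1 := h.2.reindex (fun _ => hX _) (fun _ => (measurable_affAct _).comp (hX _))
    (fun t => flow E s' t)
  have h2 := h'.2.postcomp (fun _ => hX _) (fun _ => (measurable_affAct _).comp (hX _))
    (measurable_affAct T)
  have h3 := (h1 I).trans (h2 I)
  have h4 : ∀ x, affAct (T * T') x = affAct T (affAct T' x) := fun x => by
    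
    have h5 : T' (x, 1) = (affAct T' x, 1) := h'.1.apply_one x
    change (T (T' (x, 1))).1 = (T (affAct T' x, 1)).1
    rw [h5]
  simpa only [flow_add, h4] using h3

/-- If `T` were not onto, a nonzero functional would vanish on its range, which is an affine relation
for the full vector `X (e^{sE} t₀)`. -/
lemma injective_of_mem_scalingSet (hX : IsRandomField X) (hproper : IsProper P X)
    {t₀ : EuclideanSpace ℝ (Fin d)} (ht₀ : t₀ ≠ 0) {s : ℝ}
    {T : EuclideanSpace ℝ (Fin m) × ℝ →L[ℝ] EuclideanSpace ℝ (Fin m) × ℝ}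
    (h : (s, T) ∈ scalingSet P X E F) : Function.Injective T := by
  have hsurj : Function.Surjective
        (T : EuclideanSpace ℝ (Fin m) × ℝ →ₗ[ℝ] EuclideanSpace ℝ (Fin m) × ℝ) := by
    rw [← LinearMap.range_eq_top]
    by_contra hne
    obtain ⟨ψ, hψ0, hψ⟩ := Submodule.exists_le_ker_of_lt_top _ (lt_top_iff_ne_top.2 hne)
    have hψT : ∀ p, ψ (T p) = 0 := fun p => hψ ⟨p, rfl⟩
    have h0 : LinearMap.toContinuousLinearMap ψ = 0 := by
      refine (hproper _ (flow_ne_zero (E := E) s ht₀)).eq_zero_of_ae (hX _) ?_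
      have hm : Measurable fun x : EuclideanSpace ℝ (Fin m) =>
          LinearMap.toContinuousLinearMap ψ (x, 1) :=
        (by fun_prop : Continuous fun x : EuclideanSpace ℝ (Fin m) =>
          LinearMap.toContinuousLinearMap ψ (x, 1)).measurable
      have hlaw := (h.2.postcomp (fun _ => hX _) (fun _ => (measurable_affAct _).comp (hX _))
        hm).map_eq (fun _ => hm.comp (hX _))
        (fun _ => hm.comp ((measurable_affAct _).comp (hX _))) t₀
      refine ae_eq_of_map_eq_of_ae_eq_const (hm.comp ((measurable_affAct T).comp (hX t₀)))
        (hm.comp (hX _)) hlaw.symm (ae_of_all _ fun ω => ?_)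
      change ψ (affAct T (X t₀ ω), 1) = 0
      rw [← h.1.apply_one, hψT]
    exact hψ0 (LinearMap.toContinuousLinearMap.injective (by simpa using h0))
  exact LinearMap.injective_iff_surjective.2 hsurj

lemma exists_inv_mem_scalingSet (hX : IsRandomField X) (hproper : IsProper P X)
    {t₀ : EuclideanSpace ℝ (Fin d)} (ht₀ : t₀ ≠ 0) {s : ℝ}
    {T : EuclideanSpace ℝ (Fin m) × ℝ →L[ℝ] EuclideanSpace ℝ (Fin m) × ℝ}
    (h : (s, T) ∈ scalingSet P X E F) : ∃ S, (-s, S) ∈ scalingSet P X E F ∧ T * S = 1 := by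
  have hinj := injective_of_mem_scalingSet hX hproper ht₀ h
  let e := (LinearEquiv.ofInjectiveEndo
    (T : EuclideanSpace ℝ (Fin m) × ℝ →ₗ[ℝ] EuclideanSpace ℝ (Fin m) × ℝ)
    hinj).toContinuousLinearEquiv
  have he : ∀ p, e p = T p := fun p => rfl
  have hTS : ∀ p, T (e.symm p) = p := fun p => by rw [← he, e.apply_symm_apply]
  have hST : ∀ p, e.symm (T p) = p := fun p => by rw [← he, e.symm_apply_apply]
  refine ⟨e.symm, ⟨⟨fun p => ?_, fun x hx => ?_⟩, fun I => ?_⟩, ?_⟩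
  · rw [← h.1.snd_apply]; exact congrArg Prod.snd (hTS p)
  · change e.symm (x, 1) = _
    conv_lhs => rw [← h.1.fixes x hx]
    exact hST _
  · have h1 := (h.2.reindex (fun _ => hX _) (fun _ => (measurable_affAct _).comp (hX _))
      (fun t => flow E (-s) t)).postcomp (fun _ => hX _)
        (fun _ => (measurable_affAct _).comp (hX _))
        (measurable_affAct (e.symm : _ →L[ℝ] _)) I
    have h2 : ∀ x, affAct (e.symm : _ →L[ℝ] EuclideanSpace ℝ (Fin m) × ℝ) (affAct T x) = x := by
      intro x
      change (e.symm (affAct T x, 1)).1 = x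
      rw [← h.1.apply_one, hST]
    simpa only [← flow_add, add_neg_cancel, flow_zero_left, h2] using h1.symm
  · exact ContinuousLinearMap.ext hTS

/-- Affine maps relating the field to its rescalings by bounded scales are bounded: a limit `S` of
their normalisations would satisfy `S (X t₀, 1) = 0` almost surely, because the rescaled values
`X (e ^ (s E) t₀)` are tight. -/
lemma exists_norm_le_of_mem_scalingSet (hX : IsRandomField X)
    (hcont : StochasticallyContinuous P X) (hproper : IsProper P X) (hE : E ∈ Q d)
    {t₀ : EuclideanSpace ℝ (Fin d)} (ht₀ : t₀ ≠ 0) :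
    ∃ C, ∀ s T, (s, T) ∈ scalingSet P X E F → s ≤ 1 → ‖T‖ ≤ C := by
  by_contra! hcon
  choose s T hT hs hnorm using fun n : ℕ => hcon n
  have hTpos : ∀ n, 0 < ‖T n‖ := fun n => (Nat.cast_nonneg n).trans_lt (hnorm n)
  have hinv : Tendsto (fun n => ‖T n‖⁻¹) atTop (𝓝 0) :=
    tendsto_inv_atTop_zero.comp
      (tendsto_atTop_mono (fun n => (hnorm n).le) tendsto_natCast_atTop_atTop)
  -- A subsequence along which both the normalised maps and the points `e ^ (s E) t₀` converge.
  obtain ⟨R, hR⟩ := exists_norm_flow_le hE t₀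
  obtain ⟨⟨S, t'⟩, hS, φ, hφ, hlim⟩ :=
    ((isCompact_sphere (0 : EuclideanSpace ℝ (Fin m) × ℝ →L[ℝ] EuclideanSpace ℝ (Fin m) × ℝ)
      1).prod (isCompact_closedBall (0 : EuclideanSpace ℝ (Fin d)) R)).tendsto_subseq
      (x := fun n => (‖T n‖⁻¹ • T n, flow E (s n) t₀)) fun n => ⟨by
        simp [norm_smul, (hTpos n).ne'], by simpa using hR _ (hs n)⟩
  have hlim1 := (continuous_fst.tendsto _).comp hlim
  have hlim2 := (continuous_snd.tendsto _).comp hlim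
  obtain ⟨ψ, hψ, hae⟩ := ((hcont t').comp hlim2).exists_seq_tendsto_ae
  have hφψ := hφ.tendsto_atTop.comp hψ.tendsto_atTop
  have hm : ∀ c : ℝ, Measurable fun x : EuclideanSpace ℝ (Fin m) => c • (x, (1 : ℝ)) := fun c => by
    fun_prop
  have hmS : ∀ S : EuclideanSpace ℝ (Fin m) × ℝ →L[ℝ] EuclideanSpace ℝ (Fin m) × ℝ,
      Measurable fun x : EuclideanSpace ℝ (Fin m) => S (x, 1) := fun S =>
    (by fun_prop : Continuous fun x : EuclideanSpace ℝ (Fin m) => S (x, 1)).measurable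
  have hlaw : P.map (fun _ : Ω => (0 : EuclideanSpace ℝ (Fin m) × ℝ)) =
      P.map fun ω => S (X t₀ ω, 1) := by
    refine map_eq_of_tendsto_ae
      (U := fun n ω => ‖T (φ (ψ n))‖⁻¹ • (X (flow E (s (φ (ψ n))) t₀) ω, (1 : ℝ)))
      (W := fun n ω => (‖T (φ (ψ n))‖⁻¹ • T (φ (ψ n))) (X t₀ ω, 1))
      (fun n => (hm _).comp (hX _)) (fun n => (hmS _).comp (hX _)) measurable_const
      ((hmS _).comp (hX _)) (fun n => ?_) ?_ (ae_of_all _ fun ω => ?_)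
    · have h1 := ((hT (φ (ψ n))).2.postcomp (fun _ => hX _)
        (fun _ => (measurable_affAct _).comp (hX _)) (hm ‖T (φ (ψ n))‖⁻¹)).map_eq
        (fun _ => (hm _).comp (hX _))
        (fun _ => (hm _).comp ((measurable_affAct _).comp (hX _))) t₀
      simp only [← (hT (φ (ψ n))).1.apply_one] at h1
      exact h1
    · filter_upwards [hae] with ω hω
      simpa using (hinv.comp hφψ).smul (hω.prodMk_nhds (tendsto_const_nhds (x := (1 : ℝ))))
    · exact (((ContinuousLinearMap.apply ℝ _ (X t₀ ω, (1 : ℝ))).continuous.tendsto S).comp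
        (hlim1.comp hψ.tendsto_atTop))
  have hS0 : S = 0 := (hproper t₀ ht₀).eq_zero_of_ae (hX t₀)
    (ae_eq_of_map_eq_of_ae_eq_const measurable_const ((hmS S).comp (hX t₀)) hlaw
      (ae_of_all _ fun _ => rfl))
  simp [hS0] at hS

lemma isScalingGroup_scalingSet (hX : IsRandomField X)
    (hcont : StochasticallyContinuous P X) (hproper : IsProper P X) (hE : E ∈ Q d)
    {t₀ : EuclideanSpace ℝ (Fin d)} (ht₀ : t₀ ≠ 0)
    (h : ∀ s, ∃ T, (s, T) ∈ scalingSet P X E F) : IsScalingGroup (scalingSet P X E F) where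
  isClosed := isClosed_scalingSet hX hcont
  one_mem := one_mem_scalingSet
  mul_mem := mul_mem_scalingSet hX
  exists_inv := exists_inv_mem_scalingSet hX hproper ht₀
  bounded := exists_norm_le_of_mem_scalingSet hX hcont hproper hE ht₀
  exists_mem := h

end

end Scaling

/-! ### The exponent of an operator-self-similar field -/

section Exponent

open NormedSpace

lemma exp_apply_of_semiconj {V W : Type*} [NormedAddCommGroup V] [NormedSpace ℝ V]
    [CompleteSpace V] [NormedAddCommGroup W] [NormedSpace ℝ W] [CompleteSpace W]
    {A : V →L[ℝ] V} {B : W →L[ℝ] W} {f : V →L[ℝ] W} (h : ∀ x, B (f x) = f (A x)) (x : V) :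
    exp B (f x) = f (exp A x) := by
  have hpow : ∀ n : ℕ, (B ^ n) (f x) = f ((A ^ n) x) := by
    intro n
    induction n with
    | zero => rfl
    | succ n ih => rw [pow_succ', pow_succ', mul_apply_eq_comp, mul_apply_eq_comp, ih, h]
  have hB := (exp_series_hasSum_exp' (𝕂 := ℝ) B).mapL (ContinuousLinearMap.apply ℝ W (f x))
  have hA := ((exp_series_hasSum_exp' (𝕂 := ℝ) A).mapL (ContinuousLinearMap.apply ℝ V x)).mapL f
  refine hB.unique (hA.congr_fun fun n => ?_)
  simp [hpow]

/-- The derivative at `u = 0` of an invariance under `exp (u • A)`. -/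
lemma apply_eq_zero_of_exp_smul_invariant {V W : Type*} [NormedAddCommGroup V] [NormedSpace ℝ V]
    [CompleteSpace V] [NormedAddCommGroup W] [NormedSpace ℝ W] {A : V →L[ℝ] V} {g : V →L[ℝ] W}
    {p : V} (h : ∀ u : ℝ, g (exp (u • A) p) = g p) : g (A p) = 0 := by
  have h1 : HasDerivAt (fun u : ℝ => exp (u • A)) A 0 := by
    simpa using hasDerivAt_exp_smul_const (𝕂 := ℝ) A (0 : ℝ)
  have h2 := (g.comp (ContinuousLinearMap.apply ℝ V p)).hasFDerivAt.comp_hasDerivAt 0 h1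
  have h3 : HasDerivAt (fun _ : ℝ => g p) (g (A p)) 0 := by
    simpa [Function.comp_def, h] using h2
  exact h3.unique (hasDerivAt_const _ _)

variable {d m : ℕ} {Ω : Type*} [MeasurableSpace Ω] {P : Measure Ω}
  {X : EuclideanSpace ℝ (Fin d) → Ω → EuclideanSpace ℝ (Fin m)} {E : Matrix (Fin d) (Fin d) ℝ}
  {F : Set (EuclideanSpace ℝ (Fin m))}

/-- An affine map `x ↦ B x + a` as an element of the scaling set. -/
lemma mem_scalingSet_of_fddEq {s : ℝ} {B : Matrix (Fin m) (Fin m) ℝ}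
    {a : EuclideanSpace ℝ (Fin m)} (hF : ∀ x ∈ F, act B x + a = x)
    (h : FDDEq P (fun t ω => X (flow E s t) ω) (fun t ω => act B (X t ω) + a)) :
    ∃ T, (s, T) ∈ scalingSet P X E F := by
  let V := EuclideanSpace ℝ (Fin m)
  let T : V × ℝ →L[ℝ] V × ℝ :=
    ((Matrix.toEuclideanCLM (𝕜 := ℝ) B : V →L[ℝ] V).comp (ContinuousLinearMap.fst ℝ V ℝ) +
      (ContinuousLinearMap.snd ℝ V ℝ).smulRight a).prod (ContinuousLinearMap.snd ℝ V ℝ)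
  have hT : ∀ x, T (x, 1) = (act B x + a, 1) := fun x => by
    simp [T, act]
  refine ⟨T, ⟨fun _ => rfl, fun x hx => by rw [hT, hF x hx]⟩, ?_⟩
  simpa only [affAct, hT] using h

variable [IsProbabilityMeasure P]

/-- If every scale admits an affine map fixing `F`, these maps can be chosen as a one-parameter
group, with linear part `e^{uD}` and translation part `b u`. -/
theorem exists_exponent (hX : IsRandomField X) (hcont : StochasticallyContinuous P X)
    (hproper : IsProper P X) (hE : E ∈ Q d) {t₀ : EuclideanSpace ℝ (Fin d)} (ht₀ : t₀ ≠ 0)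
    (h : ∀ s, ∃ T, (s, T) ∈ scalingSet P X E F) :
    ∃ (D : Matrix (Fin m) (Fin m) ℝ) (b : ℝ → EuclideanSpace ℝ (Fin m)), Continuous b ∧
      (∃ C, ∀ u : ℝ, u ≤ 0 → ∀ x, ‖act (exp (u • D)) x‖ ≤ C * ‖x‖) ∧
      (∀ u, FDDEq P (fun t ω => X (flow E u t) ω)
        (fun t ω => act (exp (u • D)) (X t ω) + b u)) ∧
      ∀ u, ∀ x ∈ F, act (exp (u • D)) x + b u = x := by
  have hgrp := isScalingGroup_scalingSet hX hcont hproper hE ht₀ h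
  obtain ⟨G, hG⟩ := hgrp.exists_oneParameter
  obtain ⟨C, hC⟩ := hgrp.bounded
  let V := EuclideanSpace ℝ (Fin m)
  let L : V →L[ℝ] V :=
    ((ContinuousLinearMap.fst ℝ V ℝ).comp G).comp (ContinuousLinearMap.inl ℝ V ℝ)
  -- The operators `exp (u • G)` preserve the last coordinate, so `G` maps into `ℝᵐ × {0}`.
  have hG2 : ∀ p, (G p).2 = 0 := fun p =>
    apply_eq_zero_of_exp_smul_invariant (g := ContinuousLinearMap.snd ℝ V ℝ)
      fun u => (hG u).1.snd_apply p
  let D : Matrix (Fin m) (Fin m) ℝ := (Matrix.toEuclideanCLM (n := Fin m) (𝕜 := ℝ)).symm L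
  have hD : ∀ (u : ℝ) x, exp (u • G) (x, 0) = (act (exp (u • D)) x, 0) := by
    intro u x
    rw [act_exp_smul, StarAlgEquiv.apply_symm_apply]
    refine exp_apply_of_semiconj (f := ContinuousLinearMap.inl ℝ V ℝ) (A := u • L) (fun y => ?_) x
    exact Prod.ext rfl (by simp [hG2])
  have haff : ∀ (u : ℝ) x,
      affAct (exp (u • G)) x = act (exp (u • D)) x + (exp (u • G) (0, 1)).1 := by
    intro u x
    have h1 : ((x, 1) : V × ℝ) = (x, 0) + (0, 1) := by simp
    rw [affAct, h1, map_add, hD]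
    rfl
  refine ⟨D, fun u => (exp (u • G) (0, 1)).1, ?_, ⟨C, fun u hu x => ?_⟩, fun u => ?_,
    fun u x hx => ?_⟩
  · exact continuous_fst.comp (continuous_exp_smul_apply _ _)
  · have h1 := (exp (u • G)).le_of_opNorm_le (hC u _ (hG u) (hu.trans zero_le_one)) (x, 0)
    rw [hD] at h1
    simpa [Prod.norm_def] using h1
  · simpa only [haff] using (hG u).2
  · rw [← haff, affAct, (hG u).1.fixes x hx]

lemma mem_M_of_norm_act_le {D : Matrix (Fin m) (Fin m) ℝ} {C : ℝ}
    (h : ∀ u : ℝ, u ≤ 0 → ∀ x, ‖act (exp (u • D)) x‖ ≤ C * ‖x‖) : D ∈ M m := by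
  refine mem_M_of_bounded fun x => ⟨C * ‖WithLp.toLp 2 x‖, fun u hu => ?_⟩
  have h1 := h u hu (WithLp.toLp 2 x)
  exact (pi_norm_le_iff_of_nonneg ((norm_nonneg _).trans h1)).2 fun i =>
    (PiLp.norm_apply_le (act (exp (u • D)) (WithLp.toLp 2 x)) i).trans h1

lemma continuous_act (A : Matrix (Fin m) (Fin m) ℝ) : Continuous (act A) :=
  (Matrix.toEuclideanCLM (n := Fin m) (𝕜 := ℝ) A).continuous

/-- If the exponent lies in `Q(ℝᵐ)`, then `X 0` has the same law as `r ^ D • X 0`, which vanishes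
in the limit `r → 0`. -/
lemma ae_eq_zero_of_mem_Q (hX : IsRandomField X) {D : Matrix (Fin m) (Fin m) ℝ}
    (hD : ∀ u, FDDEq P (fun t ω => X (flow E u t) ω) (fun t ω => act (exp (u • D)) (X t ω)))
    (hDQ : D ∈ Q m) : ∀ᵐ ω ∂P, X 0 ω = 0 := by
  have hm : ∀ u : ℝ, ∀ t, Measurable fun ω => act (exp (u • D)) (X t ω) := fun u t =>
    (continuous_act _).measurable.comp (hX t)
  have hlaw : P.map (fun _ : Ω => (0 : EuclideanSpace ℝ (Fin m))) = P.map (X 0) := by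
    refine map_eq_of_tendsto_ae (U := fun n ω => act (exp ((-n : ℝ) • D)) (X 0 ω))
      (W := fun _ => X 0) (fun n => hm _ _) (fun _ => hX 0) measurable_const (hX 0) (fun n => ?_)
      (ae_of_all _ fun ω => ?_) (ae_of_all _ fun ω => tendsto_const_nhds)
    · simpa using ((hD (-n)).map_eq (fun _ => hX _) (hm _) 0).symm
    · exact (tendsto_act_exp_of_mem_Q hDQ _).comp
        (tendsto_neg_atTop_atBot.comp tendsto_natCast_atTop_atTop)
  exact ae_eq_of_map_eq_of_ae_eq_const measurable_const (hX 0) hlaw (ae_of_all _ fun _ => rfl)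

/-- If `X 0 = 0`, a limit point `B` of `r ^ D` for `r → 0` satisfies `B (X t₀) = 0` almost surely,
so it vanishes by fullness. -/
lemma mem_Q_of_ae_eq_zero (hX : IsRandomField X) (hcont : StochasticallyContinuous P X)
    (hproper : IsProper P X) (hE : E ∈ Q d) {t₀ : EuclideanSpace ℝ (Fin d)} (ht₀ : t₀ ≠ 0)
    {D : Matrix (Fin m) (Fin m) ℝ} {C : ℝ}
    (hC : ∀ u : ℝ, u ≤ 0 → ∀ x, ‖act (exp (u • D)) x‖ ≤ C * ‖x‖)
    (hD : ∀ u, FDDEq P (fun t ω => X (flow E u t) ω) (fun t ω => act (exp (u • D)) (X t ω)))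
    (h0 : ∀ᵐ ω ∂P, X 0 ω = 0) : D ∈ Q m := by
  let V := EuclideanSpace ℝ (Fin m)
  let T : ℕ → V →L[ℝ] V := fun n => Matrix.toEuclideanCLM (𝕜 := ℝ) (exp ((-n : ℝ) • D))
  have hT : ∀ n, T n ∈ Metric.closedBall (0 : V →L[ℝ] V) (max C 0) := fun n => by
    rw [mem_closedBall_zero_iff]
    exact (T n).opNorm_le_bound (le_max_right _ _) fun x => (hC (-n) (by simp) x).trans
      (mul_le_mul_of_nonneg_right (le_max_left _ _) (norm_nonneg x))
  obtain ⟨B, -, φ, hφ, hlim⟩ := (isCompact_closedBall _ _).tendsto_subseq hT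
  have hflow : Tendsto (fun n => flow E (-(φ n : ℝ)) t₀) atTop (𝓝 0) :=
    (tendsto_flow_atBot hE t₀).comp
      (tendsto_neg_atTop_atBot.comp (tendsto_natCast_atTop_atTop.comp hφ.tendsto_atTop))
  obtain ⟨ψ, hψ, hae⟩ := ((hcont 0).comp hflow).exists_seq_tendsto_ae
  have hm : ∀ u : ℝ, ∀ t, Measurable fun ω => act (exp (u • D)) (X t ω) := fun u t =>
    (continuous_act _).measurable.comp (hX t)
  have hmB : Measurable fun ω => B (X t₀ ω) := B.continuous.measurable.comp (hX t₀)
  have hBlim : ∀ x, Tendsto (fun n => T (φ n) x) atTop (𝓝 (B x)) := fun x =>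
    ((ContinuousLinearMap.apply ℝ V x).continuous.tendsto B).comp hlim
  have hlaw : P.map (X 0) = P.map fun ω => B (X t₀ ω) :=
    map_eq_of_tendsto_ae (U := fun n => X (flow E (-(φ (ψ n) : ℝ)) t₀))
      (W := fun n ω => T (φ (ψ n)) (X t₀ ω)) (fun n => hX _) (fun n => hm _ _) (hX 0) hmB
      (fun n => (hD (-(φ (ψ n) : ℝ))).map_eq (fun _ => hX _) (hm _) t₀) hae
      (ae_of_all _ fun ω => (hBlim _).comp hψ.tendsto_atTop)
  have hB : B.comp (ContinuousLinearMap.fst ℝ V ℝ) = 0 :=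
    (hproper t₀ ht₀).eq_zero_of_ae (hX t₀)
      (ae_eq_of_map_eq_of_ae_eq_const (hX 0) hmB hlaw h0)
  have hB0 : ∀ x, B x = 0 := fun x => congrArg (fun S => S (x, (0 : ℝ))) hB
  refine mem_Q_of_tendsto (u := fun k => -(φ k : ℝ)) (fun k => by simp) fun x => ?_
  have h1 := hBlim (WithLp.toLp 2 x)
  rw [hB0] at h1
  exact ((PiLp.continuous_ofLp 2 fun _ : Fin m => ℝ).tendsto 0).comp h1

end Exponent

end OSS

theorem mainTheorem2 {d m : ℕ} (hd : 2 ≤ d) (hm : 2 ≤ m)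
    {Ω : Type*} [MeasurableSpace Ω] (P : Measure Ω) [IsProbabilityMeasure P]
    (X : EuclideanSpace ℝ (Fin d) → Ω → EuclideanSpace ℝ (Fin m))
    (hX : OSS.IsRandomField X)
    (hcont : OSS.StochasticallyContinuous P X)
    (hproper : OSS.IsProper P X)
    (E : Matrix (Fin d) (Fin d) ℝ) (hE : E ∈ OSS.Q d) :
    (OSS.IsOSS P X E →
      ∃ D ∈ OSS.M m,
        (∀ r : ℝ, 0 < r →
          OSS.FDDEq P (fun t ω => X (OSS.act (OSS.rpowMat r E) t) ω)
            (fun t ω => OSS.act (OSS.rpowMat r D) (X t ω))) ∧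
        (D ∈ OSS.Q m ↔ ∀ᵐ ω ∂P, X 0 ω = 0)) ∧
    (OSS.IsOSSHudsonMason P X E →
      ∃ D ∈ OSS.M m, ∃ b : ℝ → EuclideanSpace ℝ (Fin m),
        ContinuousOn b (Set.Ioi 0) ∧
        ∀ r : ℝ, 0 < r →
          OSS.FDDEq P (fun t ω => X (OSS.act (OSS.rpowMat r E) t) ω)
            (fun t ω => OSS.act (OSS.rpowMat r D) (X t ω) + b r)) := by
  have : Nonempty (Fin d) := ⟨⟨0, by lia⟩⟩
  obtain ⟨t₀, ht₀⟩ := exists_ne (0 : EuclideanSpace ℝ (Fin d))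
  have hrpow : ∀ s : ℝ, OSS.rpowMat (Real.exp s) E = NormedSpace.exp (s • E) := fun s => by
    rw [OSS.rpowMat, Real.log_exp]
  constructor
  · intro h
    have hzero : ∀ A : Matrix (Fin m) (Fin m) ℝ, OSS.act A 0 = 0 := fun A =>
      map_zero (Matrix.toEuclideanCLM (n := Fin m) (𝕜 := ℝ) A)
    have hex : ∀ s, ∃ T, (s, T) ∈ OSS.scalingSet P X E {0} := fun s => by
      obtain ⟨B, hB⟩ := h (Real.exp s) (Real.exp_pos s)
      rw [hrpow] at hB
      exact OSS.mem_scalingSet_of_fddEq (B := B) (a := 0) (by simp [hzero]) (by simpa [OSS.flow] using hB)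
    obtain ⟨D, b, -, ⟨C, hC⟩, hfdd, hfix⟩ :=
      OSS.exists_exponent hX hcont hproper hE ht₀ hex
    have hb : ∀ u, b u = 0 := fun u => by simpa [hzero] using hfix u 0 rfl
    simp only [hb, add_zero] at hfdd
    exact ⟨D, OSS.mem_M_of_norm_act_le hC, fun r _ => hfdd (Real.log r),
      OSS.ae_eq_zero_of_mem_Q hX hfdd,
      OSS.mem_Q_of_ae_eq_zero hX hcont hproper hE ht₀ hC hfdd⟩
  · intro h
    have hex : ∀ s, ∃ T, (s, T) ∈ OSS.scalingSet P X E ∅ := fun s => by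
      obtain ⟨B, a, hB⟩ := h (Real.exp s) (Real.exp_pos s)
      rw [hrpow] at hB
      exact OSS.mem_scalingSet_of_fddEq (B := B) (a := a) (by simp) hB
    obtain ⟨D, b, hb, ⟨C, hC⟩, hfdd, -⟩ := OSS.exists_exponent hX hcont hproper hE ht₀ hex
    exact ⟨D, OSS.mem_M_of_norm_act_le hC, fun r => b (Real.log r),
      hb.comp_continuousOn (Real.continuousOn_log.mono fun r hr => ne_of_gt hr),
      fun r _ => hfdd (Real.log r)⟩
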